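/- Let $H$ be an infinite-dimensional separable complex Hilbert space with a fixed orthonormal basis $\{e_k\}_{k\in\mathbb N}$. Let $C$ be a compact Hermitian operator on $H$ and let $D_1$ be a compact real diagonal operator, i.e. a compact Hermitian operator with $\langle D_1e_i,e_j\rangle=0$ for all $i\ne j$. Write $\lambda_{\max}$ and $\lambda_{\min}$ for the largest and the smallest element of the spectrum of $C+D_1$, and $E_+$, $E_-$ for the corresponding spectral projections, i.e. the orthogonal projections onto $\ker(C+D_1-\lambda_{\max})$ and $\ker(C+D_1-\lambda_{\min})$. For a bounded operator $X$ put $|X|=(X^*X)^{1/2}$, $X^+=\tfrac12(|X|+X)$ and $X^-=\tfrac12(|X|-X)$; let $\|\cdot\|$ be the operator norm and $\|X\|_1=\operatorname{tr}|X|$ the trace norm. The following statements are equivalent: 1. $C+D_1$ is minimal, that is, $\|C+D_1\|\le\|C+D\|$ for every compact real diagonal operator $D$. 2. There is a trace class operator $X\neq0$ on $H$ such that $\langle Xe_i,e_i\rangle=0$ for all $i$, $|\operatorname{tr}(X(C+D_1))|=\|C+D_1\|\,\|X\|_1$, $E_+X^+=X^+$ and $E_-X^-=X^-$. 2′. There is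 a Hermitian trace class operator $X\ne 0$ with the properties listed in 2. 3. $\lambda_{\min}+\lambda_{\max}=0$, and for every compact real diagonal operator $D$ there are $y\in R(E_+)$ and $z\in R(E_-)$ with $\|y\|=\|z\|=1$ and $\langle Dy,y\rangle\le\langle Dz,z\rangle$, where $R(\cdot)$ denotes the range. -/

import Mathlib

noncomputable section

namespace MinimalCompact

variable {H : Type*} [NormedAddCommGroup H] [InnerProductSpace ℂ H] [CompleteSpace H]

/-- Compact Hermitian operators on `H`. -/
def IsCompactHermitian (T : H →L[ℂ] H) : Prop :=
  IsCompactOperator T ∧ IsSelfAdjoint T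

/-- Compact real diagonal operators: compact Hermitian operators whose matrix in the
orthonormal basis `e` vanishes off the diagonal. -/
def IsCompactRealDiagonal (e : HilbertBasis ℕ ℂ H) (D : H →L[ℂ] H) : Prop :=
  IsCompactHermitian D ∧ ∀ i j : ℕ, i ≠ j → inner ℂ (e j) (D (e i)) = 0

/-- `C + D₁` is minimal: `D₁` is a best approximant of `C` among the compact real diagonal
operators, for the operator norm. -/
def IsMinimal (e : HilbertBasis ℕ ℂ H) (C D₁ : H →L[ℂ] H) : Prop :=
  ∀ D : H →L[ℂ] H, IsCompactRealDiagonal e D → ‖C + D₁‖ ≤ ‖C + D‖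

/-- The absolute value `|T| = (T* T)^{1/2}`. -/
def absOp (T : H →L[ℂ] H) : H →L[ℂ] H := CFC.abs T

/-- The positive part `(|T| + T) / 2`. -/
def posPartOp (T : H →L[ℂ] H) : H →L[ℂ] H := (1 / 2 : ℂ) • (absOp T + T)

/-- The negative part `(|T| - T) / 2`. -/
def negPartOp (T : H →L[ℂ] H) : H →L[ℂ] H := (1 / 2 : ℂ) • (absOp T - T)

/-- `T` is of trace class: the sum of the nonnegative numbers `⟨|T| e_i, e_i⟩` is finite. -/
def IsTraceClass (e : HilbertBasis ℕ ℂ H) (T : H →L[ℂ] H) : Prop :=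
  Summable fun i : ℕ => (inner ℂ (e i) (absOp T (e i))).re

/-- The trace, computed in the orthonormal basis `e`. -/
def trace (e : HilbertBasis ℕ ℂ H) (T : H →L[ℂ] H) : ℂ :=
  ∑' i : ℕ, inner ℂ (e i) (T (e i))

/-- The trace norm `tr |T|`. -/
def traceNorm (e : HilbertBasis ℕ ℂ H) (T : H →L[ℂ] H) : ℝ :=
  ∑' i : ℕ, (inner ℂ (e i) (absOp T (e i))).re

/-- The largest element of the spectrum of a Hermitian operator. -/
def lambdaMax (A : H →L[ℂ] H) : ℝ := sSup (spectrum ℝ A)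

/-- The smallest element of the spectrum of a Hermitian operator. -/
def lambdaMin (A : H →L[ℂ] H) : ℝ := sInf (spectrum ℝ A)

/-- The spectral projection of a Hermitian operator `A` for the real number `r`: the orthogonal
projection onto `ker (A - r)`. -/
def spectralProj (A : H →L[ℂ] H) (r : ℝ) : H →L[ℂ] H :=
  (A - (r : ℂ) • (1 : H →L[ℂ] H)).ker.starProjection

/-- `E₊`, the spectral projection for `λ_max`. -/
def projMax (A : H →L[ℂ] H) : H →L[ℂ] H := spectralProj A (lambdaMax A)

/-- `E₋`, the spectral projection for `λ_min`. -/
def projMin (A : H →L[ℂ] H) : H →L[ℂ] H := spectralProj A (lambdaMin A)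

/-- `X` is a nonzero trace class operator with zero diagonal, at which the trace pairing with `A`
attains the bound `‖A‖ ‖X‖₁`, and `E₊ X⁺ = X⁺`, `E₋ X⁻ = X⁻` for the extreme spectral projections
`E₊`, `E₋` of `A`. -/
structure IsWitness (e : HilbertBasis ℕ ℂ H) (A X : H →L[ℂ] H) : Prop where
  traceClass : IsTraceClass e X
  ne_zero : X ≠ 0
  diag_eq_zero : ∀ i : ℕ, inner ℂ (e i) (X (e i)) = 0
  norm_trace : ‖trace e (X * A)‖ = ‖A‖ * traceNorm e X
  projMax_mul : projMax A * posPartOp X = posPartOp X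
  projMin_mul : projMin A * negPartOp X = negPartOp X

end MinimalCompact

end

/-! Put `A = C + D₁`. All conditions are tied to one finite object, a certificate: a convex
combination of signed projections `s j |x j⟩⟨x j|` onto unit eigenvectors for `s j ‖A‖`, `s j = ±1`,
whose diagonal vanishes. For `A ≠ 0` the eigenspaces for `±‖A‖` are finite-dimensional, so the
signed diagonals of these projections form a compact set whose convex hull is compact in `ℝ^ℕ`.
Either the hull contains 0, which is a certificate, or Hahn–Banach gives a functional positive on
it; being continuous on `ℝ^ℕ`, it has finite support and is a diagonal operator `D` separating the
two families of eigenvectors (`exists_certificate_or_separates`).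

Separation contradicts minimality, because `A - ε D` then has smaller norm for small `ε > 0`
(`exists_norm_sub_smul_lt`), and contradicts condition 3 directly. A certificate is itself a
Hermitian witness (`IsCertificate.isWitness`), and averaging over its two signs gives condition 3. A
witness gives minimality by trace duality: its zero diagonal makes `tr (X (C + D))` independent of
`D`, and `|tr (X B)| ≤ ‖B‖ ‖X‖₁` (`norm_trace_mul_le`). -/

noncomputable section

namespace MinimalCompact

open scoped ENNReal
open Filter Topology ContinuousLinearMap

/-! ### Trace duality: a witness implies minimality. -/

section TraceInequality

variable {H : Type*} [NormedAddCommGroup H] [InnerProductSpace ℂ H]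

/-- Parseval's identity. -/
theorem hasSum_norm_inner_sq (e : HilbertBasis ℕ ℂ H) (x : H) :
    HasSum (fun i => ‖inner ℂ (e i) x‖ ^ 2) (‖x‖ ^ 2) := by
  have h := (Complex.hasSum_re (e.hasSum_inner_mul_inner x x))
  convert h using 1
  · ext i
    rw [← inner_conj_symm x (e i), ← Complex.normSq_eq_conj_mul_self, Complex.ofReal_re,
      Complex.normSq_eq_norm_sq]
  · exact norm_sq_eq_re_inner (𝕜 := ℂ) x

theorem tsum_enorm_inner_sq (e : HilbertBasis ℕ ℂ H) (x : H) :
    ∑' i, ‖inner ℂ (e i) x‖ₑ ^ 2 = ‖x‖ₑ ^ 2 := by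
  have h := hasSum_norm_inner_sq e x
  have h2 := ENNReal.ofReal_tsum_of_nonneg (fun i => sq_nonneg ‖inner ℂ (e i) x‖) h.summable
  rw [h.tsum_eq] at h2
  simp only [ENNReal.ofReal_pow (norm_nonneg _), ofReal_norm] at h2
  exact h2.symm

theorem tsum_enorm_mul_sq_le (e : HilbertBasis ℕ ℂ H) (B T : H →L[ℂ] H) :
    ∑' i, ‖(B * T) (e i)‖ₑ ^ 2 ≤ ‖B‖ₑ ^ 2 * ∑' i, ‖T (e i)‖ₑ ^ 2 := by
  rw [← ENNReal.tsum_mul_left]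
  refine ENNReal.tsum_le_tsum fun i => ?_
  rw [← mul_pow]
  gcongr
  exact B.le_opENorm _

variable [CompleteSpace H]

/-- An operator and its adjoint have the same Hilbert–Schmidt norm. -/
theorem tsum_enorm_adjoint_sq (e : HilbertBasis ℕ ℂ H) (T : H →L[ℂ] H) :
    ∑' i, ‖(star T) (e i)‖ₑ ^ 2 = ∑' i, ‖T (e i)‖ₑ ^ 2 := by
  simp_rw [← tsum_enorm_inner_sq e]
  rw [ENNReal.tsum_comm]
  refine tsum_congr fun i => tsum_congr fun j => ?_
  rw [star_eq_adjoint, adjoint_inner_right, ← inner_conj_symm, ← ofReal_norm,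
    ← ofReal_norm, RCLike.norm_conj]

/-- If `Q` is self-adjoint and Hilbert–Schmidt then so is `Q B`, with the obvious bound. -/
theorem sum_norm_mul_sq_le (e : HilbertBasis ℕ ℂ H) {Q : H →L[ℂ] H} (hQ : IsSelfAdjoint Q)
    {τ : ℝ} (hτ : HasSum (fun i => ‖Q (e i)‖ ^ 2) τ) (B : H →L[ℂ] H) (s : Finset ℕ) :
    ∑ i ∈ s, ‖Q (B (e i))‖ ^ 2 ≤ ‖B‖ ^ 2 * τ := by
  have hτ0 : 0 ≤ τ := hτ.nonneg fun i => sq_nonneg _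
  have h1 : ∑' i, ‖(Q * B) (e i)‖ₑ ^ 2 ≤ ‖B‖ₑ ^ 2 * ∑' i, ‖Q (e i)‖ₑ ^ 2 := by
    -- Passing to the adjoint turns `Q B` into `B* Q`, where the bounded factor acts last and is
    -- estimated vector by vector.
    rw [← tsum_enorm_adjoint_sq, star_mul, hQ.star_eq]
    refine (tsum_enorm_mul_sq_le e _ _).trans_eq ?_
    rw [← ofReal_norm, norm_star, ofReal_norm]
  have h2 : ∑' i, ‖Q (e i)‖ₑ ^ 2 = ENNReal.ofReal τ := by
    rw [← hτ.tsum_eq, ENNReal.ofReal_tsum_of_nonneg (fun i => sq_nonneg _) hτ.summable]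
    simp only [ENNReal.ofReal_pow (norm_nonneg _), ofReal_norm]
  rw [h2] at h1
  have h3 := (ENNReal.sum_le_tsum s).trans h1
  rw [← ofReal_norm, ← ENNReal.ofReal_pow (norm_nonneg _),
    ← ENNReal.ofReal_mul (by positivity)] at h3
  simp only [← ofReal_norm, ← ENNReal.ofReal_pow (norm_nonneg _)] at h3
  rw [← ENNReal.ofReal_sum_of_nonneg (fun i _ => by positivity),
    ENNReal.ofReal_le_ofReal_iff (by positivity)] at h3
  exact h3

theorem absOp_nonneg (X : H →L[ℂ] H) : 0 ≤ absOp X := CFC.abs_nonneg X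

theorem isSelfAdjoint_absOp (X : H →L[ℂ] H) : IsSelfAdjoint (absOp X) :=
  IsSelfAdjoint.of_nonneg (absOp_nonneg X)

theorem norm_absOp_apply (X : H →L[ℂ] H) (v : H) : ‖absOp X v‖ = ‖X v‖ := by
  have h : absOp X * absOp X = star X * X := CFC.abs_mul_abs X
  have h1 : inner ℂ (absOp X v) (absOp X v) = inner ℂ (X v) (X v) := by
    rw [← adjoint_inner_right, ← adjoint_inner_right, ← star_eq_adjoint, ← star_eq_adjoint,
      (isSelfAdjoint_absOp X).star_eq, ← mul_apply_eq_comp, ← mul_apply_eq_comp, h]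
  rw [← sq_eq_sq₀ (norm_nonneg _) (norm_nonneg _), norm_sq_eq_re_inner (𝕜 := ℂ), h1,
    ← norm_sq_eq_re_inner]

/-- Approximate polar decomposition: `X = U (|X| + ε)` with a contraction `U`. -/
theorem exists_contraction_mul_absOp_add (X : H →L[ℂ] H) {ε : ℝ} (hε : 0 < ε) :
    ∃ U : H →L[ℂ] H, ‖U‖ ≤ 1 ∧ X = U * (absOp X + (ε : ℂ) • 1) := by
  have hP := absOp_nonneg X
  have hu : IsUnit (absOp X + (ε : ℂ) • (1 : H →L[ℂ] H)) := by
    have h1 : (-ε : ℝ) ∉ spectrum ℝ (absOp X) := fun h =>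
      absurd (spectrum_nonneg_of_nonneg hP h) (by linarith)
    rw [spectrum.notMem_iff] at h1
    have h2 := h1.neg
    convert h2 using 1
    ext v
    simp [add_comm, Algebra.algebraMap_eq_smul_one]
  obtain ⟨u, hu⟩ := hu
  refine ⟨X * ↑u⁻¹, ?_, ?_⟩
  · refine opNorm_le_bound _ zero_le_one fun v => ?_
    set w := (↑u⁻¹ : H →L[ℂ] H) v
    have hw : absOp X w + (ε : ℂ) • w = v := by
      have : (absOp X + (ε : ℂ) • (1 : H →L[ℂ] H)) w = v := by
        rw [← hu, ← mul_apply_eq_comp, u.mul_inv, one_apply_eq_self]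
      simpa using this
    have hpos : 0 ≤ (inner ℂ (absOp X w) w).re :=
      ((nonneg_iff_isPositive _).1 hP).re_inner_nonneg_left w
    -- The cross term is nonnegative, so `‖(|X| + ε) w‖ ≥ ‖|X| w‖ = ‖X w‖`; this makes `X (|X| +
    -- ε)⁻¹` a contraction.
    have h1 : ‖v‖ ^ 2 = ‖absOp X w‖ ^ 2 + 2 * (ε * (inner ℂ (absOp X w) w).re)
        + ‖(ε : ℂ) • w‖ ^ 2 := by
      rw [← hw, norm_add_sq (𝕜 := ℂ), inner_smul_right]
      simp
    rw [one_mul, mul_apply_eq_comp, ← norm_absOp_apply]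
    change ‖absOp X w‖ ≤ _
    rw [← sq_le_sq₀ (norm_nonneg _) (norm_nonneg _), h1]
    nlinarith [mul_nonneg hε.le hpos, sq_nonneg ‖(ε : ℂ) • w‖]
  · rw [mul_assoc, ← hu, u.inv_mul, mul_one]

theorem sqrt_absOp_norm_sq (X : H →L[ℂ] H) (v : H) :
    ‖CFC.sqrt (absOp X) v‖ ^ 2 = (inner ℂ v (absOp X v)).re := by
  have hs : IsSelfAdjoint (CFC.sqrt (absOp X)) := IsSelfAdjoint.of_nonneg (CFC.sqrt_nonneg _)
  conv_rhs => rw [← CFC.sqrt_mul_sqrt_self (absOp X) (absOp_nonneg X)]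
  rw [mul_apply_eq_comp, ← adjoint_inner_left, ← star_eq_adjoint, hs.star_eq,
    norm_sq_eq_re_inner (𝕜 := ℂ)]
  rfl

theorem hasSum_sqrt_absOp {e : HilbertBasis ℕ ℂ H} {X : H →L[ℂ] H} (hX : IsTraceClass e X) :
    HasSum (fun i => ‖CFC.sqrt (absOp X) (e i)‖ ^ 2) (traceNorm e X) := by
  simp_rw [sqrt_absOp_norm_sq]
  exact Summable.hasSum hX

/-- With `Q = √|X|` each term is `⟨Q U* e i, Q B e i⟩`; Cauchy–Schwarz and the Hilbert–Schmidt bound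
for both factors finish. -/
theorem sum_norm_inner_mul_absOp_mul_le {e : HilbertBasis ℕ ℂ H} {X : H →L[ℂ] H}
    (hX : IsTraceClass e X) {U : H →L[ℂ] H} (hU : ‖U‖ ≤ 1) (B : H →L[ℂ] H) (s : Finset ℕ) :
    ∑ i ∈ s, ‖inner ℂ (e i) ((U * absOp X * B) (e i))‖ ≤ ‖B‖ * traceNorm e X := by
  set Q := CFC.sqrt (absOp X) with hQ
  have hs : IsSelfAdjoint Q := IsSelfAdjoint.of_nonneg (CFC.sqrt_nonneg _)
  have hsum := hasSum_sqrt_absOp hX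
  rw [← hQ] at hsum
  have hτ0 : 0 ≤ traceNorm e X := hsum.nonneg fun i => sq_nonneg _
  have h1 : ∀ i, ‖inner ℂ (e i) ((U * absOp X * B) (e i))‖ ≤
      ‖Q ((star U) (e i))‖ * ‖Q (B (e i))‖ := fun i => by
    rw [← CFC.sqrt_mul_sqrt_self (absOp X) (absOp_nonneg X), ← hQ]
    simp only [mul_apply_eq_comp]
    rw [← adjoint_inner_left, ← star_eq_adjoint, ← adjoint_inner_left Q, ← star_eq_adjoint,
      hs.star_eq]
    exact norm_inner_le_norm _ _
  refine (Finset.sum_le_sum fun i _ => h1 i).trans ?_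
  refine (Real.sum_mul_le_sqrt_mul_sqrt _ _ _).trans ?_
  have h2 := sum_norm_mul_sq_le e hs hsum (star U) s
  have h3 := sum_norm_mul_sq_le e hs hsum B s
  have h4 : ‖star U‖ ^ 2 * traceNorm e X ≤ traceNorm e X := by
    rw [norm_star]
    exact mul_le_of_le_one_left hτ0 (pow_le_one₀ (norm_nonneg _) hU)
  calc _ ≤ √(traceNorm e X) * √(‖B‖ ^ 2 * traceNorm e X) := by
        gcongr; exact h2.trans h4
    _ = _ := by
        rw [Real.sqrt_mul (by positivity), Real.sqrt_sq (norm_nonneg _), mul_left_comm,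
          Real.mul_self_sqrt hτ0]

theorem sum_norm_inner_mul_le {e : HilbertBasis ℕ ℂ H} {X : H →L[ℂ] H}
    (hX : IsTraceClass e X) (B : H →L[ℂ] H) (s : Finset ℕ) :
    ∑ i ∈ s, ‖inner ℂ (e i) ((X * B) (e i))‖ ≤ ‖B‖ * traceNorm e X := by
  -- Replacing `X` by `U |X|` costs at most `ε ‖B‖` per term; as `s` is finite, the error vanishes
  -- when `ε → 0`.
  have key : ∀ ε : ℝ, 0 < ε → ∑ i ∈ s, ‖inner ℂ (e i) ((X * B) (e i))‖ ≤
      ‖B‖ * traceNorm e X + ε * (s.card * ‖B‖) := fun ε hε => by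
    obtain ⟨U, hU, hXU⟩ := exists_contraction_mul_absOp_add X hε
    have h1 : ∀ i, ‖inner ℂ (e i) ((X * B) (e i))‖ ≤
        ‖inner ℂ (e i) ((U * absOp X * B) (e i))‖ + ε * ‖B‖ := fun i => by
      have h2 : (X * B) (e i) = (U * absOp X * B) (e i) + (ε : ℂ) • U (B (e i)) := by
        conv_lhs => rw [hXU]
        simp
      rw [h2, inner_add_right]
      refine (norm_add_le _ _).trans ?_
      gcongr
      refine (norm_inner_le_norm _ _).trans ?_
      rw [norm_smul, e.orthonormal.1 i, one_mul, Complex.norm_real, Real.norm_of_nonneg hε.le]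
      gcongr
      refine (U.le_opNorm _).trans ((mul_le_of_le_one_left (norm_nonneg _) hU).trans ?_)
      simpa [e.orthonormal.1 i] using B.le_opNorm (e i)
    refine (Finset.sum_le_sum fun i _ => h1 i).trans ?_
    rw [Finset.sum_add_distrib, Finset.sum_const, nsmul_eq_mul]
    have := sum_norm_inner_mul_absOp_mul_le hX hU B s
    linarith
  have hlim : Tendsto (fun ε : ℝ => ‖B‖ * traceNorm e X + ε * (s.card * ‖B‖)) (𝓝[>] 0)
      (𝓝 (‖B‖ * traceNorm e X + 0 * (s.card * ‖B‖))) :=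
    (Continuous.tendsto (by fun_prop) _).mono_left nhdsWithin_le_nhds
  rw [zero_mul, add_zero] at hlim
  exact ge_of_tendsto hlim (eventually_mem_nhdsWithin.mono key)

/-- `|tr (X B)| ≤ ‖B‖ ‖X‖₁`. -/
theorem norm_trace_mul_le {e : HilbertBasis ℕ ℂ H} {X : H →L[ℂ] H}
    (hX : IsTraceClass e X) (B : H →L[ℂ] H) :
    ‖trace e (X * B)‖ ≤ ‖B‖ * traceNorm e X := by
  have hs : Summable fun i => ‖inner ℂ (e i) ((X * B) (e i))‖ :=
    summable_of_sum_le (fun _ => norm_nonneg _) (sum_norm_inner_mul_le hX B)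
  exact (norm_tsum_le_tsum_norm hs).trans
    (hs.tsum_le_of_sum_le (sum_norm_inner_mul_le hX B))

theorem traceNorm_pos {e : HilbertBasis ℕ ℂ H} {X : H →L[ℂ] H}
    (hX : IsTraceClass e X) (h0 : X ≠ 0) : 0 < traceNorm e X := by
  have hsum := hasSum_sqrt_absOp hX
  refine (hsum.nonneg fun i => sq_nonneg _).lt_of_ne fun h => h0 ?_
  rw [← h, hasSum_zero_iff_of_nonneg fun i => sq_nonneg _] at hsum
  have h1 : CFC.sqrt (absOp X) = 0 := by
    refine ContinuousLinearMap.ext_on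
      (Submodule.dense_iff_topologicalClosure_eq_top.2 e.dense_span) ?_
    rintro _ ⟨i, rfl⟩
    simpa using congrFun hsum i
  have h2 : absOp X = 0 := by
    rw [← CFC.sqrt_mul_sqrt_self (absOp X) (absOp_nonneg X), h1, mul_zero]
  ext v
  have h3 := norm_absOp_apply X v
  rw [h2, zero_apply, norm_zero] at h3
  simpa using h3.symm

theorem IsCompactRealDiagonal.apply_basis {e : HilbertBasis ℕ ℂ H} {D : H →L[ℂ] H}
    (hD : IsCompactRealDiagonal e D) (i : ℕ) : D (e i) = inner ℂ (e i) (D (e i)) • e i := by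
  have h := e.hasSum_repr (D (e i))
  simp only [e.repr_apply_apply] at h
  refine h.unique (hasSum_single (f := fun j => inner ℂ (e j) (D (e i)) • e j) i fun j hj => ?_)
  rw [hD.2 i j hj.symm, zero_smul]

theorem trace_mul_add_eq {e : HilbertBasis ℕ ℂ H} {X D : H →L[ℂ] H} (C : H →L[ℂ] H)
    (hX : ∀ i, inner ℂ (e i) (X (e i)) = 0) (hD : IsCompactRealDiagonal e D) :
    trace e (X * (C + D)) = trace e (X * C) := by
  refine tsum_congr fun i => ?_
  simp only [mul_apply_eq_comp, add_apply, map_add, inner_add_right]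
  rw [hD.apply_basis i, map_smul, inner_smul_right, hX, mul_zero, add_zero]

theorem isMinimal_of_isWitness {e : HilbertBasis ℕ ℂ H} {C D₁ X : H →L[ℂ] H}
    (hD₁ : IsCompactRealDiagonal e D₁) (hX : IsWitness e (C + D₁) X) : IsMinimal e C D₁ := by
  intro D hD
  have h := norm_trace_mul_le hX.traceClass (C + D)
  rw [trace_mul_add_eq C hX.diag_eq_zero hD, ← trace_mul_add_eq C hX.diag_eq_zero hD₁,
    hX.norm_trace] at h
  exact le_of_mul_le_mul_right h (traceNorm_pos hX.traceClass hX.ne_zero)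

end TraceInequality

/-! ### Compactness of convex hulls, and the dual of `ℝ^ℕ`. -/

section ConvexHull

/-- The convex hull of a compact set that lies in a finite-dimensional subspace is compact. -/
theorem isCompact_convexHull_of_subset {E : Type*} [AddCommGroup E] [Module ℝ E]
    [TopologicalSpace E] [IsTopologicalAddGroup E] [ContinuousSMul ℝ E] {s : Set E}
    (hs : IsCompact s) (W : Submodule ℝ E) [FiniteDimensional ℝ W] (hsW : s ⊆ W) :
    IsCompact (convexHull ℝ s) := by
  rcases s.eq_empty_or_nonempty with rfl | ⟨x₀, hx₀⟩
  · simp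
  -- Carathéodory: `dim W + 1` points suffice, so the hull is a continuous image of a simplex times
  -- `s^N`. Unused slots get weight 0 and the point `x₀`.
  set N := Module.finrank ℝ W + 1
  set f : (Fin N → ℝ) × (Fin N → E) → E := fun p => ∑ i, p.1 i • p.2 i with hf
  have hcomp : IsCompact (stdSimplex ℝ (Fin N) ×ˢ Set.univ.pi fun _ : Fin N => s) :=
    (isCompact_stdSimplex ℝ _).prod (isCompact_univ_pi fun _ => hs)
  convert hcomp.image (f := f) (by fun_prop)
  refine Set.Subset.antisymm (fun x hx => ?_) ?_
  · rw [convexHull_eq_union] at hx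
    simp only [Set.mem_iUnion] at hx
    obtain ⟨t, hts, hti, hxt⟩ := hx
    rw [Finset.mem_convexHull'] at hxt
    obtain ⟨w, hw0, hw1, hwx⟩ := hxt
    have hcard : Fintype.card t ≤ Fintype.card (Fin N) := by
      rw [Fintype.card_fin]
      refine hti.card_le_finrank_succ.trans (Nat.add_le_add_right ?_ 1)
      refine Submodule.finrank_mono ?_
      rw [vectorSpan_def, Submodule.span_le]
      rintro _ ⟨_, ⟨a, rfl⟩, _, ⟨b, rfl⟩, rfl⟩
      exact W.sub_mem (hsW (hts a.2)) (hsW (hts b.2))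
    obtain ⟨g⟩ := Function.Embedding.nonempty_of_card_le hcard
    have hout : ∀ i, i ∉ Set.range g → Function.extend g (fun y : t => w y) 0 i = 0 :=
      fun i hi => Function.extend_apply' _ _ _ hi
    refine ⟨(Function.extend g (fun y : t => w y) 0,
      Function.extend g (fun y : t => (y : E)) fun _ => x₀), ⟨⟨fun i => ?_, ?_⟩, fun i _ => ?_⟩, ?_⟩
    · by_cases hi : i ∈ Set.range g
      · obtain ⟨y, rfl⟩ := hi
        simpa [g.injective.extend_apply] using hw0 y y.2
      · exact (hout i hi).ge
    · rw [← hw1, ← Finset.sum_coe_sort t]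
      refine (Finset.sum_of_injOn g g.injective.injOn (fun _ _ => Finset.mem_coe.2 (Finset.mem_univ _))
        (fun i _ hi => hout i ?_) fun y _ => ?_).symm
      · rwa [Finset.coe_univ, Set.image_univ] at hi
      · rw [g.injective.extend_apply]
    · by_cases hi : i ∈ Set.range g
      · obtain ⟨y, rfl⟩ := hi
        simpa [g.injective.extend_apply] using hts y.2
      · simpa [Function.extend_apply' _ _ _ (show ¬∃ a, g a = i by simpa using hi)] using hx₀
    · rw [← hwx, ← Finset.sum_coe_sort t]
      refine (Finset.sum_of_injOn g g.injective.injOn (fun _ _ => Finset.mem_coe.2 (Finset.mem_univ _))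
        (fun i _ hi => ?_)
        fun y _ => ?_).symm
      · simp [hout i (by simpa using hi)]
      · simp [g.injective.extend_apply]
  · rintro _ ⟨⟨w, x⟩, ⟨⟨hw0, hw1⟩, hx⟩, rfl⟩
    exact (convex_convexHull ℝ s).sum_mem (fun i _ => hw0 i) hw1
      fun i _ => subset_convexHull ℝ s (hx i trivial)

/-- Continuous linear functionals on `ℝ^ℕ` depend on finitely many coordinates. -/
theorem exists_finset_sum_of_clm (f : (ℕ → ℝ) →L[ℝ] ℝ) :
    ∃ (I : Finset ℕ) (a : ℕ → ℝ), ∀ x, f x = ∑ i ∈ I, a i * x i := by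
  have h : {x | ‖f x‖ < 1} ∈ 𝓝 (0 : ℕ → ℝ) :=
    (isOpen_lt (by fun_prop) continuous_const).mem_nhds (by simp)
  rw [nhds_pi, Filter.mem_pi] at h
  obtain ⟨I, hI, t, ht, hsub⟩ := h
  -- The neighbourhood constrains only coordinates in `I`, so a multiple of `x` with `f = 1` would
  -- still lie in it.
  have hvan : ∀ x : ℕ → ℝ, (∀ i ∈ I, x i = 0) → f x = 0 := fun x hx => by
    by_contra hne
    have h1 : ((f x)⁻¹ • x) ∈ I.pi t := fun i hi => by
      simpa [hx i hi] using mem_of_mem_nhds (ht i)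
    have h2 := hsub h1
    simp [hne] at h2
  refine ⟨hI.toFinset, fun i => f (Pi.single i 1), fun x => ?_⟩
  have h3 : f (x - ∑ i ∈ hI.toFinset, x i • Pi.single i 1) = 0 := by
    refine hvan _ fun i hi => ?_
    simp [Finset.sum_apply, Pi.single_apply, hi]
  rw [map_sub, sub_eq_zero] at h3
  rw [h3, map_sum]
  exact Finset.sum_congr rfl fun i _ => by rw [map_smul, smul_eq_mul, mul_comm]

end ConvexHull

/-! ### Diagonals of rank-one projections. -/

section Weights

variable {H : Type*} [NormedAddCommGroup H] [InnerProductSpace ℂ H]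

/-- The diagonal of the rank-one operator `|x⟩⟨x|`. -/
def weights (e : HilbertBasis ℕ ℂ H) (x : H) (i : ℕ) : ℝ := ‖inner ℂ (e i) x‖ ^ 2

theorem continuous_weights (e : HilbertBasis ℕ ℂ H) : Continuous (weights e) :=
  continuous_pi fun i => by unfold weights; fun_prop

/-- The diagonals of the operators `|x⟩⟨x|`, for `x` in a finite-dimensional subspace, lie in a
finite-dimensional space. -/
theorem exists_finiteDimensional_weights_mem (e : HilbertBasis ℕ ℂ H) (F : Submodule ℂ H)
    [FiniteDimensional ℂ F] :
    ∃ W : Submodule ℝ (ℕ → ℝ), FiniteDimensional ℝ W ∧ ∀ x ∈ F, weights e x ∈ W := by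
  -- A real bilinear map restricting to `weights e` on the diagonal; its values on `F × F` span a
  -- finite-dimensional space.
  set B : H →ₗ[ℝ] H →ₗ[ℝ] (ℕ → ℝ) := LinearMap.mk₂ ℝ
    (fun x y i => (inner ℂ x (e i) * inner ℂ (e i) y).re)
    (fun x x' y => by ext i; simp; ring)
    (fun c x y => by
      ext i
      rw [← Complex.coe_smul, inner_smul_left]
      simp; ring)
    (fun x y y' => by ext i; simp; ring)
    (fun c x y => by
      ext i
      rw [← Complex.coe_smul c y, inner_smul_right]
      simp; ring) with hB
  have hF : (F.restrictScalars ℝ).FG := by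
    rw [← Module.Finite.iff_fg]
    exact FiniteDimensional.complexToReal F
  refine ⟨Submodule.map₂ B (F.restrictScalars ℝ) (F.restrictScalars ℝ),
    Module.Finite.iff_fg.2 (hF.map₂ B hF), fun x hx => ?_⟩
  have : weights e x = B x x := by
    ext i
    simp only [hB, LinearMap.mk₂_apply, weights]
    rw [← inner_conj_symm x (e i), ← Complex.normSq_eq_conj_mul_self, Complex.ofReal_re,
      Complex.normSq_eq_norm_sq]
  rw [this]
  exact Submodule.apply_mem_map₂ _ hx hx

end Weights

/-! ### Eigenspaces of compact operators. -/

section Eigenspaces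

variable {H : Type*} [NormedAddCommGroup H] [InnerProductSpace ℂ H]

/-- On the eigenspace the identity equals `μ⁻¹ A`, hence is compact, and Riesz's theorem applies. -/
theorem finiteDimensional_eigenspace {A : H →L[ℂ] H} (hA : IsCompactOperator A) {μ : ℂ}
    (hμ : μ ≠ 0) : FiniteDimensional ℂ (A - μ • (1 : H →L[ℂ] H)).ker := by
  set F := (A - μ • (1 : H →L[ℂ] H)).ker with hF
  have hmem : ∀ x ∈ F, A x = μ • x := fun x hx => by
    simpa [hF, sub_eq_zero] using hx
  have hcl : IsClosed (F : Set H) := (A - μ • (1 : H →L[ℂ] H)).isClosed_ker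
  have h1 : IsCompactOperator (fun x : F => μ⁻¹ • A x) := (hA.comp_clm F.subtypeL).smul μ⁻¹
  have h2 : ∀ x : F, μ⁻¹ • A x = x := fun x => by
    rw [hmem x x.2, smul_smul, inv_mul_cancel₀ hμ, one_smul]
  refine FiniteDimensional.of_isCompactOperator_id (𝕜 := ℂ) ?_
  have h3 := IsCompactOperator.codRestrict (f := F.subtype) (V := F) (by
    rw [funext h2] at h1
    exact h1) (fun x => x.2) hcl
  exact h3

theorem mem_eigenspace {A : H →L[ℂ] H} {μ : ℂ} {x : H} :
    x ∈ (A - μ • (1 : H →L[ℂ] H)).ker ↔ A x = μ • x := by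
  simp [sub_eq_zero]

/-- Unit eigenvectors of `A` for the eigenvalue `s ‖A‖`. -/
def unitEigenvectors (A : H →L[ℂ] H) (s : ℝ) : Set H :=
  {x | ‖x‖ = 1 ∧ A x = ((s * ‖A‖ : ℝ) : ℂ) • x}

theorem isCompact_unitEigenvectors {A : H →L[ℂ] H} (hA : IsCompactOperator A) (h0 : A ≠ 0)
    {s : ℝ} (hs : s ≠ 0) : IsCompact (unitEigenvectors A s) := by
  have hμ : ((s * ‖A‖ : ℝ) : ℂ) ≠ 0 := by simp [hs, h0]
  have := finiteDimensional_eigenspace hA hμ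
  set F := (A - ((s * ‖A‖ : ℝ) : ℂ) • (1 : H →L[ℂ] H)).ker
  have : ProperSpace F := FiniteDimensional.proper_rclike ℂ F
  convert (isCompact_sphere (0 : F) 1).image continuous_subtype_val
  ext x
  simp only [unitEigenvectors, Set.mem_image, mem_sphere_zero_iff_norm, Subtype.exists,
    Set.mem_ofPred_eq]
  constructor
  · exact fun h => ⟨x, mem_eigenspace.2 h.2, h.1, rfl⟩
  · rintro ⟨y, hy, hy1, rfl⟩
    exact ⟨hy1, mem_eigenspace.1 hy⟩

end Eigenspaces

/-! ### Diagonal operators of finite rank. -/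

section Diagonal

variable {H : Type*} [NormedAddCommGroup H] [InnerProductSpace ℂ H]

/-- The diagonal operator with the entries `a i`, `i ∈ I`, and zero elsewhere. -/
def finiteDiagonal (e : HilbertBasis ℕ ℂ H) (I : Finset ℕ) (a : ℕ → ℝ) : H →L[ℂ] H :=
  ∑ i ∈ I, (a i : ℂ) • InnerProductSpace.rankOne ℂ (e i) (e i)

theorem isCompactOperator_rankOne (x y : H) :
    IsCompactOperator (InnerProductSpace.rankOne ℂ x y) := by
  rw [InnerProductSpace.rankOne_def']
  have h : IsCompactOperator (innerSL ℂ y) :=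
    isCompactOperator_of_locallyCompactSpace_dom (innerSL ℂ y)
  exact h.clm_comp (ContinuousLinearMap.toSpanSingleton ℂ x)

theorem isCompactRealDiagonal_finiteDiagonal [CompleteSpace H] (e : HilbertBasis ℕ ℂ H)
    (I : Finset ℕ) (a : ℕ → ℝ) : IsCompactRealDiagonal e (finiteDiagonal e I a) := by
  refine ⟨⟨?_, ?_⟩, fun i j hij => ?_⟩
  · exact Submodule.sum_mem (compactOperator (RingHom.id ℂ) H H)
      fun i _ => (isCompactOperator_rankOne (e i) (e i)).smul (a i : ℂ)
  · refine isSelfAdjoint_sum _ fun i _ => ?_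
    refine IsSelfAdjoint.smul (Complex.conj_ofReal _) ?_
    exact (InnerProductSpace.isPositive_rankOne_self (e i)).isSelfAdjoint
  · simp only [finiteDiagonal, sum_apply, smul_apply, InnerProductSpace.rankOne_apply, inner_sum]
    refine Finset.sum_eq_zero fun k _ => ?_
    rw [inner_smul_right, inner_smul_right]
    rcases eq_or_ne k i with rfl | hk
    · rw [e.orthonormal.2 hij.symm]; simp
    · rw [e.orthonormal.2 hk]; simp

/-- Turns a finitely supported functional of the weights into the quadratic form of a diagonal
operator. -/
theorem inner_finiteDiagonal (e : HilbertBasis ℕ ℂ H) (I : Finset ℕ) (a : ℕ → ℝ) (x : H) :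
    (inner ℂ x (finiteDiagonal e I a x)).re = ∑ i ∈ I, a i * weights e x i := by
  simp only [finiteDiagonal, sum_apply, smul_apply, InnerProductSpace.rankOne_apply, inner_sum]
  rw [Complex.re_sum]
  refine Finset.sum_congr rfl fun i _ => ?_
  rw [inner_smul_right, inner_smul_right, ← inner_conj_symm x (e i), Complex.mul_conj, weights,
    Complex.normSq_eq_norm_sq, ← Complex.ofReal_mul, Complex.ofReal_re]

end Diagonal

/-! ### The alternative: certificate or separation. -/

section Certificate

variable {H : Type*} [NormedAddCommGroup H] [InnerProductSpace ℂ H]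

/-- A finite convex combination of signed rank-one projections, onto eigenvectors of `A` for the
eigenvalues `± ‖A‖`, with zero diagonal. -/
structure IsCertificate (e : HilbertBasis ℕ ℂ H) (A : H →L[ℂ] H) {ι : Type} [Fintype ι]
    (w s : ι → ℝ) (x : ι → H) : Prop where
  nonneg : ∀ j, 0 ≤ w j
  sum_eq_one : ∑ j, w j = 1
  sign : ∀ j, s j = 1 ∨ s j = -1
  mem : ∀ j, x j ∈ unitEigenvectors A (s j)
  inner_eq_zero : ∀ j k, s j ≠ s k → inner ℂ (x j) (x k) = 0
  diag : ∀ i, ∑ j, w j * (s j * weights e (x j) i) = 0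

/-- `D` is positive on the unit eigenvectors of `A` for `‖A‖` and negative on those for
`-‖A‖`. -/
def Separates (A D : H →L[ℂ] H) : Prop :=
  (∀ x ∈ unitEigenvectors A 1, 0 < (inner ℂ x (D x)).re) ∧
    ∀ x ∈ unitEigenvectors A (-1), (inner ℂ x (D x)).re < 0

theorem inner_eq_zero_of_sign_ne [CompleteSpace H] {A : H →L[ℂ] H} (hA : IsSelfAdjoint A)
    (h0 : A ≠ 0) {s t : ℝ} (hst : s ≠ t) {x y : H} (hx : x ∈ unitEigenvectors A s)
    (hy : y ∈ unitEigenvectors A t) : inner ℂ x y = 0 := by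
  have h : inner ℂ (A x) y = inner ℂ x (A y) := hA.isSymmetric x y
  rw [hx.2, hy.2, inner_smul_left, inner_smul_right, Complex.conj_ofReal] at h
  have h2 : ((((s - t) * ‖A‖ : ℝ)) : ℂ) * inner ℂ x y = 0 := by
    push_cast at h ⊢
    linear_combination h
  refine (mul_eq_zero.1 h2).resolve_left ?_
  exact_mod_cast mul_ne_zero (sub_ne_zero.2 hst) (norm_ne_zero_iff.2 h0)

/-- Either the convex hull of the diagonals contains zero, or a diagonal operator of finite rank
separates the eigenvectors for `‖A‖` from those for `-‖A‖`. -/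
theorem exists_certificate_or_separates [CompleteSpace H] (e : HilbertBasis ℕ ℂ H)
    {A : H →L[ℂ] H} (hA : IsCompactHermitian A) (h0 : A ≠ 0) :
    (∃ (ι : Type) (_ : Fintype ι) (w s : ι → ℝ) (x : ι → H), IsCertificate e A w s x) ∨
      ∃ D, IsCompactRealDiagonal e D ∧ Separates A D := by
  set S : Set (ℕ → ℝ) := weights e '' unitEigenvectors A 1 ∪
    (fun x => -weights e x) '' unitEigenvectors A (-1) with hS
  have hScomp : IsCompact S :=
    ((isCompact_unitEigenvectors hA.1 h0 one_ne_zero).image (continuous_weights e)).union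
      ((isCompact_unitEigenvectors hA.1 h0 (by norm_num)).image (continuous_weights e).neg)
  have hW : ∀ s : ℝ, s ≠ 0 → ∃ W : Submodule ℝ (ℕ → ℝ), FiniteDimensional ℝ W ∧
      ∀ x ∈ unitEigenvectors A s, weights e x ∈ W := fun s hs => by
    have := finiteDimensional_eigenspace hA.1 (μ := ((s * ‖A‖ : ℝ) : ℂ)) (by simp [hs, h0])
    obtain ⟨W, hW, hx⟩ := exists_finiteDimensional_weights_mem e
      (A - ((s * ‖A‖ : ℝ) : ℂ) • (1 : H →L[ℂ] H)).ker
    exact ⟨W, hW, fun x h => hx x (mem_eigenspace.2 h.2)⟩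
  obtain ⟨W₁, hW₁, h₁⟩ := hW 1 one_ne_zero
  obtain ⟨W₂, hW₂, h₂⟩ := hW (-1) (by norm_num)
  have hSW : S ⊆ (W₁ ⊔ W₂ : Submodule ℝ (ℕ → ℝ)) := by
    rintro _ (⟨x, hx, rfl⟩ | ⟨x, hx, rfl⟩)
    · exact (le_sup_left : W₁ ≤ W₁ ⊔ W₂) (h₁ x hx)
    · exact (le_sup_right : W₂ ≤ W₁ ⊔ W₂) (W₂.neg_mem (h₂ x hx))
  have hcomp := isCompact_convexHull_of_subset hScomp (W₁ ⊔ W₂) hSW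
  by_cases hmem : (0 : ℕ → ℝ) ∈ convexHull ℝ S
  · left
    rw [mem_convexHull_iff_exists_fintype] at hmem
    obtain ⟨ι, hι, w, z, hw, hw1, hz, hsum⟩ := hmem
    have hz' : ∀ j, ∃ (s : ℝ) (x : H), (s = 1 ∨ s = -1) ∧ x ∈ unitEigenvectors A s ∧
        z j = s • weights e x := fun j => by
      rcases hz j with ⟨x, hx, h⟩ | ⟨x, hx, h⟩
      · exact ⟨1, x, Or.inl rfl, hx, by rw [← h, one_smul]⟩
      · exact ⟨-1, x, Or.inr rfl, hx, by rw [← h, neg_one_smul]⟩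
    choose s x hs hx hzs using hz'
    refine ⟨ι, hι, w, s, x, hw, hw1, hs, hx,
      fun j k hjk => inner_eq_zero_of_sign_ne hA.2 h0 hjk (hx j) (hx k), fun i => ?_⟩
    have := congrFun hsum i
    simpa [hzs] using this
  · right
    -- Here `f > u > 0` on `S`; the minus sign in the second half of `S` becomes negativity on the
    -- eigenvectors for `-‖A‖`.
    obtain ⟨f, u, hu, hfu⟩ := geometric_hahn_banach_point_closed (convex_convexHull ℝ S)
      hcomp.isClosed hmem
    rw [map_zero] at hu
    obtain ⟨I, a, hfa⟩ := exists_finset_sum_of_clm f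
    refine ⟨finiteDiagonal e I a, isCompactRealDiagonal_finiteDiagonal e I a,
      fun x hx => ?_, fun x hx => ?_⟩
    · rw [inner_finiteDiagonal, ← hfa]
      exact hu.trans (hfu _ (subset_convexHull ℝ S (Or.inl ⟨x, hx, rfl⟩)))
    · rw [inner_finiteDiagonal, ← hfa]
      have := hu.trans (hfu _ (subset_convexHull ℝ S (Or.inr ⟨x, hx, rfl⟩)))
      rw [map_neg] at this
      linarith

end Certificate

/-! ### A separating diagonal operator lowers the norm. -/

section Perturbation

variable {H : Type*} [NormedAddCommGroup H] [InnerProductSpace ℂ H]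

theorem re_inner_apply_le (A : H →L[ℂ] H) {x : H} (hx : ‖x‖ = 1) :
    (inner ℂ x (A x)).re ≤ ‖A‖ := by
  have h1 := (Complex.re_le_norm _).trans (norm_inner_le_norm (𝕜 := ℂ) x (A x))
  have h2 := A.le_opNorm x
  rw [hx] at h1 h2
  linarith

/-- If `D` is positive on the eigenvectors for `‖A‖`, then the numerical range of `A - ε D` lies
to the left of `‖A‖` for all small `ε > 0`. -/
theorem exists_forall_re_inner_sub_lt {A : H →L[ℂ] H} (hA : IsCompactOperator A) (h0 : A ≠ 0)
    {D : H →L[ℂ] H} (hD : ∀ x ∈ unitEigenvectors A 1, 0 < (inner ℂ x (D x)).re) :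
    ∃ δ : ℝ, 0 < δ ∧ ∀ ε : ℝ, 0 < ε → ε ≤ δ → ∀ x : H, ‖x‖ = 1 →
      (inner ℂ x (A x)).re - ε * (inner ℂ x (D x)).re < ‖A‖ := by
  by_contra! hcon
  have hpos : ∀ n : ℕ, (0 : ℝ) < 1 / (n + 1) := fun n => Nat.one_div_pos_of_nat
  choose ε hε0 hε1 x hx hle using fun n : ℕ => hcon _ (hpos n)
  have hA0 : (‖A‖ : ℂ) ≠ 0 := by simpa using h0
  have hD0 : ∀ n, (inner ℂ (x n) (D (x n))).re ≤ 0 := fun n => by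
    have h1 := re_inner_apply_le A (hx n)
    have h2 := hle n
    by_contra! h
    have := mul_pos (hε0 n) h
    linarith
  have hεlim : Tendsto ε atTop (𝓝 0) :=
    squeeze_zero (fun n => (hε0 n).le) hε1 tendsto_one_div_add_atTop_nhds_zero_nat
  -- Almost maximal vectors are almost eigenvectors: the square is at most `2 ‖A‖ (‖A‖ - ⟨x, A x⟩)`.
  -- Compactness of `A` then gives a limit eigenvector `y` with `⟨y, D y⟩ ≤ 0`, contradicting `hD`.
  have hsq : ∀ n, ‖A (x n) - (‖A‖ : ℂ) • x n‖ ^ 2 ≤ 2 * ‖A‖ * ‖D‖ * ε n := fun n => by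
    have h1 : ‖A (x n)‖ ≤ ‖A‖ := by simpa [hx n] using A.le_opNorm (x n)
    have h2 : -(inner ℂ (x n) (D (x n))).re ≤ ‖D‖ := by
      have := re_inner_apply_le (-D) (hx n)
      simpa using this
    have h3 : RCLike.re (inner ℂ (A (x n)) ((‖A‖ : ℂ) • x n)) =
        ‖A‖ * (inner ℂ (x n) (A (x n))).re := by
      rw [inner_smul_right, ← inner_conj_symm]
      change ((‖A‖ : ℂ) * _).re = _
      rw [Complex.re_ofReal_mul, Complex.conj_re]
    rw [norm_sub_sq (𝕜 := ℂ), h3, norm_smul, hx n, Complex.norm_real, norm_norm, mul_one]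
    have h4 := mul_le_mul_of_nonneg_left (hle n) (norm_nonneg A)
    have h5 := mul_le_mul_of_nonneg_left h2 (mul_nonneg (norm_nonneg A) (hε0 n).le)
    have h6 := pow_le_pow_left₀ (norm_nonneg _) h1 2
    nlinarith
  have hdiff : Tendsto (fun n => A (x n) - (‖A‖ : ℂ) • x n) atTop (𝓝 0) := by
    rw [tendsto_zero_iff_norm_tendsto_zero]
    have h1 : Tendsto (fun n => ‖A (x n) - (‖A‖ : ℂ) • x n‖ ^ 2) atTop (𝓝 0) := by
      refine squeeze_zero (fun n => sq_nonneg _) hsq ?_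
      simpa using hεlim.const_mul (2 * ‖A‖ * ‖D‖)
    have h2 := (Real.continuous_sqrt.tendsto 0).comp h1
    simpa [Function.comp_def, Real.sqrt_sq] using h2
  obtain ⟨K, hK, hKsub⟩ := hA.image_closedBall_subset_compact 1
  obtain ⟨v, -, φ, hφ, hv⟩ := hK.tendsto_subseq (x := fun n => A (x n))
    fun n => hKsub ⟨x n, by simp [hx n], rfl⟩
  have hxlim : Tendsto (fun n => x (φ n)) atTop (𝓝 ((‖A‖ : ℂ)⁻¹ • v)) := by
    have h1 := (hv.sub (hdiff.comp hφ.tendsto_atTop)).const_smul ((‖A‖ : ℂ)⁻¹)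
    refine Tendsto.congr (fun n => ?_) (by rwa [sub_zero] at h1)
    simp only [Function.comp_apply]
    rw [sub_sub_cancel, smul_smul, inv_mul_cancel₀ hA0, one_smul]
  set y := (‖A‖ : ℂ)⁻¹ • v with hy
  have hy1 : ‖y‖ = 1 := by
    refine tendsto_nhds_unique hxlim.norm ?_
    simp [hx]
  have hAy : A y = (‖A‖ : ℂ) • y := by
    refine tendsto_nhds_unique ((A.continuous.tendsto y).comp hxlim) ?_
    rw [hy, smul_smul, mul_inv_cancel₀ hA0, one_smul]
    exact hv
  have hDy : (inner ℂ y (D y)).re ≤ 0 := by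
    have hc : Continuous fun z : H => (inner ℂ z (D z)).re := by fun_prop
    exact le_of_tendsto ((hc.tendsto y).comp hxlim) (Eventually.of_forall fun n => hD0 (φ n))
  exact absurd (hD y ⟨hy1, by rw [one_mul]; exact hAy⟩) (not_lt.2 hDy)

theorem unitEigenvectors_neg (A : H →L[ℂ] H) (s : ℝ) :
    unitEigenvectors (-A) s = unitEigenvectors A (-s) := by
  ext x
  simp [unitEigenvectors, neg_eq_iff_eq_neg]

theorem mem_spectrum_of_mem_unitEigenvectors {A : H →L[ℂ] H} {s : ℝ} {x : H}
    (hx : x ∈ unitEigenvectors A s) : s * ‖A‖ ∈ spectrum ℝ A := by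
  rintro ⟨u, hu⟩
  have h1 : (u : H →L[ℂ] H) x = 0 := by
    rw [hu, Algebra.algebraMap_eq_smul_one, sub_apply, hx.2, smul_apply, one_apply_eq_self,
      Complex.coe_smul, sub_self]
  have h2 : x = 0 := by
    rw [← one_apply_eq_self (F := H →L[ℂ] H) x, ← u.inv_mul, mul_apply_eq_comp, h1, map_zero]
  simpa [h2] using hx.1

variable [CompleteSpace H]

/-- A nonzero compact self-adjoint operator `T` has an eigenvector for `‖T‖` or for `-‖T‖`. -/
theorem unitEigenvectors_nonempty {T : H →L[ℂ] H} (hT : IsCompactHermitian T) (h0 : T ≠ 0) :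
    (unitEigenvectors T 1).Nonempty ∨ (unitEigenvectors T (-1)).Nonempty := by
  have hnt : Nontrivial (H →L[ℂ] H) := ⟨T, 0, h0⟩
  have key : ∀ s : ℝ, s ≠ 0 → s * ‖T‖ ∈ spectrum ℝ T → (unitEigenvectors T s).Nonempty := by
    intro s hs hmem
    have h1 : ((s * ‖T‖ : ℝ) : ℂ) ∈ spectrum ℂ T := spectrum.algebraMap_mem ℂ hmem
    rw [← hT.1.hasEigenvalue_iff_mem_spectrum (by simp [hs, h0])] at h1
    obtain ⟨x, hx⟩ := h1.exists_hasEigenvector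
    have hx0 : (‖x‖ : ℂ) ≠ 0 := by simpa using hx.2
    refine ⟨(‖x‖ : ℂ)⁻¹ • x, ?_, ?_⟩
    · rw [norm_smul, norm_inv, Complex.norm_real, norm_norm]
      exact inv_mul_cancel₀ (norm_ne_zero_iff.2 hx.2)
    · have h2 : T x = ((s * ‖T‖ : ℝ) : ℂ) • x := hx.apply_eq_smul
      rw [map_smul, h2, smul_comm]
  rcases CStarAlgebra.norm_or_neg_norm_mem_spectrum hT.2 with h | h
  · exact Or.inl (key 1 one_ne_zero (by simpa using h))
  · exact Or.inr (key (-1) (by norm_num) (by simpa using h))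

/-- The norm of a nonzero compact Hermitian operator is attained, up to sign, at an eigenvector. The
one-sided estimate for `(A, D)` and for `(-A, -D)` excludes both signs at the value `‖A‖` or above.
-/
theorem exists_norm_sub_smul_lt {A D : H →L[ℂ] H} (hA : IsCompactHermitian A) (h0 : A ≠ 0)
    (hD : IsCompactHermitian D) (hsep : Separates A D) :
    ∃ ε : ℝ, ‖A - (ε : ℂ) • D‖ < ‖A‖ := by
  obtain ⟨δ₁, hδ₁, h₁⟩ := exists_forall_re_inner_sub_lt hA.1 h0 hsep.1
  obtain ⟨δ₂, hδ₂, h₂⟩ := exists_forall_re_inner_sub_lt (A := -A) (D := -D) hA.1.neg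
    (neg_ne_zero.2 h0) (by
      rw [unitEigenvectors_neg]
      intro x hx
      simpa using hsep.2 x hx)
  set ε := min δ₁ δ₂
  have hε : 0 < ε := lt_min hδ₁ hδ₂
  refine ⟨ε, ?_⟩
  set T := A - (ε : ℂ) • D with hTdef
  have hT : IsCompactHermitian T :=
    ⟨hA.1.sub (hD.1.smul (ε : ℂ)), hA.2.sub (IsSelfAdjoint.smul (Complex.conj_ofReal _) hD.2)⟩
  rcases eq_or_ne T 0 with hT0 | hT0
  · rw [hT0, norm_zero]; exact norm_pos_iff.2 h0
  have hval : ∀ {s : ℝ} {x : H}, x ∈ unitEigenvectors T s →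
      (inner ℂ x (A x)).re - ε * (inner ℂ x (D x)).re = s * ‖T‖ := by
    intro s x hx
    have h3 : inner ℂ x (T x) = ((s * ‖T‖ : ℝ) : ℂ) := by
      rw [hx.2, inner_smul_right, inner_self_eq_norm_sq_to_K, hx.1]
      simp
    have h4 := congrArg Complex.re h3
    rw [Complex.ofReal_re] at h4
    rw [← h4, hTdef, sub_apply, smul_apply, inner_sub_right, inner_smul_right, Complex.sub_re,
      Complex.re_ofReal_mul]
  rcases unitEigenvectors_nonempty hT hT0 with ⟨x, hx⟩ | ⟨x, hx⟩
  · have h3 := h₁ ε hε (min_le_left _ _) x hx.1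
    rwa [hval hx, one_mul] at h3
  · have h3 := h₂ ε hε (min_le_right _ _) x hx.1
    have h4 := hval hx
    simp only [neg_apply, inner_neg_right, Complex.neg_re, norm_neg] at h3
    linarith

theorem lambdaMax_eq_norm {A : H →L[ℂ] H} (h : (unitEigenvectors A 1).Nonempty) :
    lambdaMax A = ‖A‖ := by
  obtain ⟨x, hx⟩ := h
  have hnt : Nontrivial H := ⟨x, 0, by rintro rfl; simpa using hx.1⟩
  have h1 := mem_spectrum_of_mem_unitEigenvectors hx
  rw [one_mul] at h1
  exact IsGreatest.csSup_eq ⟨h1, fun r hr =>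
    (le_abs_self r).trans (spectrum.norm_le_norm_of_mem hr)⟩

theorem lambdaMin_eq_neg_norm {A : H →L[ℂ] H} (h : (unitEigenvectors A (-1)).Nonempty) :
    lambdaMin A = -‖A‖ := by
  obtain ⟨x, hx⟩ := h
  have hnt : Nontrivial H := ⟨x, 0, by rintro rfl; simpa using hx.1⟩
  have h1 := mem_spectrum_of_mem_unitEigenvectors hx
  rw [neg_one_mul] at h1
  exact IsLeast.csInf_eq ⟨h1, fun r hr =>
    neg_le.1 ((neg_le_abs r).trans (spectrum.norm_le_norm_of_mem hr))⟩

end Perturbation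

/-! ### What a certificate implies for the extreme eigenvectors. -/

section Certificate

variable {H : Type*} [NormedAddCommGroup H] [InnerProductSpace ℂ H]

theorem hasSum_weights (e : HilbertBasis ℕ ℂ H) (x : H) : HasSum (weights e x) (‖x‖ ^ 2) :=
  hasSum_norm_inner_sq e x

/-- Some value of `d` of positive weight is at most the mean of `d`. -/
theorem exists_pos_and_le_mean {ι : Type*} [Fintype ι] {u d : ι → ℝ} (hu : ∀ j, 0 ≤ u j)
    (hu1 : ∑ j, u j = 1) : ∃ j, 0 < u j ∧ d j ≤ ∑ k, u k * d k := by
  by_contra! hcon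
  set a := ∑ k, u k * d k
  have h1 : ∑ j, u j * (d j - a) = 0 := by
    simp only [mul_sub, Finset.sum_sub_distrib, ← Finset.sum_mul, hu1]
    simp [a]
  have h2 : ∀ j, 0 ≤ u j * (d j - a) := fun j => by
    rcases (hu j).eq_or_lt with h | h
    · simp [← h]
    · exact mul_nonneg h.le (sub_nonneg.2 (hcon j h).le)
  have h3 : ∀ j, u j = 0 := fun j => by
    have h4 := (Finset.sum_eq_zero_iff_of_nonneg fun j _ => h2 j).1 h1 j (Finset.mem_univ j)
    by_contra hne
    have hpos := (hu j).lt_of_ne' hne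
    have := mul_pos hpos (sub_pos.2 (hcon j hpos))
    linarith
  simp [h3] at hu1

section Consequences

variable {ι : Type} [Fintype ι] {e : HilbertBasis ℕ ℂ H} {A : H →L[ℂ] H} {w s : ι → ℝ} {x : ι → H}

/-- Sum the zero diagonal over `i`: by Parseval each `x j` contributes total mass 1. -/
theorem IsCertificate.sum_mul_sign (h : IsCertificate e A w s x) : ∑ j, w j * s j = 0 := by
  have h1 : HasSum (fun i => ∑ j, w j * (s j * weights e (x j) i)) (∑ j, w j * (s j * 1)) := by
    refine hasSum_sum fun j _ => ?_
    have h2 := hasSum_weights e (x j)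
    rw [(h.mem j).1, one_pow] at h2
    exact (h2.mul_left _).mul_left _
  simp only [h.diag, mul_one] at h1
  exact h1.unique hasSum_zero

/-- The weights `w (1 + s)` and `w (1 - s)` are probabilities carried by the two signs, and `hd`
gives `d` the same mean under both. Some positive-sign value is at most that mean, some
negative-sign value at least. -/
theorem IsCertificate.exists_inner_le (h : IsCertificate e A w s x) {d : ι → ℝ}
    (hd : ∑ j, w j * (s j * d j) = 0) : ∃ j k, s j = 1 ∧ s k = -1 ∧ d j ≤ d k := by
  have hs : ∀ j, 0 ≤ 1 + s j ∧ 0 ≤ 1 - s j := fun j => by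
    rcases h.sign j with h | h <;> rw [h] <;> norm_num
  obtain ⟨j, hj, hjd⟩ := exists_pos_and_le_mean (u := fun j => w j * (1 + s j)) (d := d)
    (fun j => mul_nonneg (h.nonneg j) (hs j).1)
    (by simp only [mul_add, mul_one, Finset.sum_add_distrib, h.sum_eq_one, h.sum_mul_sign, add_zero])
  obtain ⟨k, hk, hkd⟩ := exists_pos_and_le_mean (u := fun j => w j * (1 - s j)) (d := fun j => -d j)
    (fun j => mul_nonneg (h.nonneg j) (hs j).2)
    (by simp only [mul_sub, mul_one, Finset.sum_sub_distrib, h.sum_eq_one, h.sum_mul_sign, sub_zero])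
  refine ⟨j, k, (h.sign j).resolve_right ?_, (h.sign k).resolve_left ?_, ?_⟩
  · intro h1; simp [h1] at hj
  · intro h1; simp [h1] at hk
  · have h1 : ∑ j, w j * (1 + s j) * d j = ∑ j, w j * d j + ∑ j, w j * (s j * d j) := by
      rw [← Finset.sum_add_distrib]
      exact Finset.sum_congr rfl fun j _ => by ring
    have h2 : ∑ j, w j * (1 - s j) * -d j = -∑ j, w j * d j + ∑ j, w j * (s j * d j) := by
      rw [← Finset.sum_neg_distrib, ← Finset.sum_add_distrib]
      exact Finset.sum_congr rfl fun j _ => by ring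
    rw [h1, hd] at hjd
    rw [h2, hd] at hkd
    linarith

variable [CompleteSpace H]

theorem IsCompactRealDiagonal.hasSum_inner {D : H →L[ℂ] H} (hD : IsCompactRealDiagonal e D)
    (y : H) : HasSum (fun i => (inner ℂ (e i) (D (e i))).re * weights e y i)
      (inner ℂ y (D y)).re := by
  have h := Complex.hasSum_re (e.hasSum_inner_mul_inner y (D y))
  convert h using 1
  ext i
  have h1 : inner ℂ (e i) (D y) = inner ℂ (D (e i)) y := (hD.1.2.isSymmetric (e i) y).symm
  rw [h1, hD.apply_basis i, inner_smul_left, mul_left_comm, ← inner_conj_symm y (e i),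
    ← Complex.normSq_eq_conj_mul_self, Complex.re_mul_ofReal, Complex.conj_re,
    Complex.normSq_eq_norm_sq]
  simp [weights, e.orthonormal.1 i]

theorem IsCertificate.sum_inner (h : IsCertificate e A w s x) {D : H →L[ℂ] H}
    (hD : IsCompactRealDiagonal e D) :
    ∑ j, w j * (s j * (inner ℂ (x j) (D (x j))).re) = 0 := by
  have h1 : HasSum (fun i => ∑ j, w j * (s j * ((inner ℂ (e i) (D (e i))).re * weights e (x j) i)))
      (∑ j, w j * (s j * (inner ℂ (x j) (D (x j))).re)) :=
    hasSum_sum fun j _ => ((hD.hasSum_inner (x j)).mul_left _).mul_left _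
  refine h1.unique ?_
  convert hasSum_zero with i
  rw [← mul_zero (inner ℂ (e i) (D (e i))).re, ← h.diag i, Finset.mul_sum]
  exact Finset.sum_congr rfl fun j _ => by ring

theorem IsCertificate.lambda_eq (h : IsCertificate e A w s x) :
    lambdaMax A = ‖A‖ ∧ lambdaMin A = -‖A‖ := by
  -- Taking `d = 0` merely records that both signs occur.
  obtain ⟨j, k, hj, hk, -⟩ := h.exists_inner_le (d := fun _ => 0) (by simp)
  exact ⟨lambdaMax_eq_norm ⟨x j, hj ▸ h.mem j⟩, lambdaMin_eq_neg_norm ⟨x k, hk ▸ h.mem k⟩⟩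

theorem mem_range_projMax {y : H} : y ∈ (projMax A).range ↔ A y = (lambdaMax A : ℂ) • y := by
  rw [projMax, spectralProj, Submodule.range_starProjection, mem_eigenspace]

theorem mem_range_projMin {y : H} : y ∈ (projMin A).range ↔ A y = (lambdaMin A : ℂ) • y := by
  rw [projMin, spectralProj, Submodule.range_starProjection, mem_eigenspace]

theorem projMax_apply_eq_self {y : H} : projMax A y = y ↔ A y = (lambdaMax A : ℂ) • y := by
  rw [projMax, spectralProj, Submodule.starProjection_eq_self_iff, mem_eigenspace]

theorem projMin_apply_eq_self {y : H} : projMin A y = y ↔ A y = (lambdaMin A : ℂ) • y := by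
  rw [projMin, spectralProj, Submodule.starProjection_eq_self_iff, mem_eigenspace]

theorem IsCertificate.exists_mem_range (h : IsCertificate e A w s x) {D : H →L[ℂ] H}
    (hD : IsCompactRealDiagonal e D) :
    ∃ y ∈ (projMax A).range, ∃ z ∈ (projMin A).range,
      ‖y‖ = 1 ∧ ‖z‖ = 1 ∧ (inner ℂ y (D y)).re ≤ (inner ℂ z (D z)).re := by
  obtain ⟨j, k, hj, hk, hle⟩ := h.exists_inner_le (h.sum_inner hD)
  refine ⟨x j, mem_range_projMax.2 ?_, x k, mem_range_projMin.2 ?_, (h.mem j).1, (h.mem k).1, hle⟩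
  · have := (h.mem j).2
    rwa [hj, one_mul, ← h.lambda_eq.1] at this
  · have := (h.mem k).2
    rwa [hk, neg_one_mul, ← h.lambda_eq.2] at this

end Consequences

end Certificate

/-! ### From a certificate to a Hermitian witness. -/

section Witness

variable {H : Type*} [NormedAddCommGroup H] [InnerProductSpace ℂ H]

/-- The finite-rank operator `∑ c j |x j⟩⟨x j|`. -/
def sumRankOne {ι : Type} [Fintype ι] (c : ι → ℝ) (x : ι → H) : H →L[ℂ] H :=
  ∑ j, (c j : ℂ) • InnerProductSpace.rankOne ℂ (x j) (x j)

variable {ι : Type} [Fintype ι]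

theorem sumRankOne_apply (c : ι → ℝ) (x : ι → H) (v : H) :
    sumRankOne c x v = ∑ j, (c j : ℂ) • inner ℂ (x j) v • x j := by
  simp [sumRankOne, sum_apply]

theorem inner_sumRankOne (e : HilbertBasis ℕ ℂ H) (c : ι → ℝ) (x : ι → H) (i : ℕ) :
    inner ℂ (e i) (sumRankOne c x (e i)) = ((∑ j, c j * weights e (x j) i : ℝ) : ℂ) := by
  rw [sumRankOne_apply, inner_sum, Complex.ofReal_sum]
  refine Finset.sum_congr rfl fun j _ => ?_
  rw [inner_smul_right, inner_smul_right, ← inner_conj_symm (x j) (e i), mul_comm (starRingEnd ℂ _),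
    Complex.mul_conj, weights, Complex.normSq_eq_norm_sq, ← Complex.ofReal_mul]

theorem sumRankOne_add (c d : ι → ℝ) (x : ι → H) :
    sumRankOne c x + sumRankOne d x = sumRankOne (c + d) x := by
  simp [sumRankOne, ← Finset.sum_add_distrib, add_smul]

theorem sumRankOne_sub (c d : ι → ℝ) (x : ι → H) :
    sumRankOne c x - sumRankOne d x = sumRankOne (c - d) x := by
  simp [sumRankOne, ← Finset.sum_sub_distrib, sub_smul]

theorem sumRankOne_mul_self (c d : ι → ℝ) (x : ι → H)
    (h : ∀ j k, c j * c k = d j * d k ∨ inner ℂ (x j) (x k) = 0) :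
    sumRankOne c x * sumRankOne c x = sumRankOne d x * sumRankOne d x := by
  ext v
  simp only [mul_apply_eq_comp, sumRankOne_apply, inner_sum, inner_smul_right, Finset.sum_smul,
    Finset.smul_sum]
  refine Finset.sum_congr rfl fun j _ => Finset.sum_congr rfl fun k _ => ?_
  rcases h j k with h | h
  · have h' : (c j : ℂ) * c k = d j * d k := by exact_mod_cast h
    rw [smul_smul, smul_smul]
    congr 1
    linear_combination (inner ℂ (x k) v * inner ℂ (x j) (x k)) * h'
  · simp [h]

variable {e : HilbertBasis ℕ ℂ H} {A : H →L[ℂ] H} {w s : ι → ℝ} {x : ι → H}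

theorem IsCertificate.hasSum_diag (h : IsCertificate e A w s x) :
    HasSum (fun i => ∑ j, w j * weights e (x j) i) 1 := by
  rw [← h.sum_eq_one]
  refine hasSum_sum fun j _ => ?_
  have h2 := (hasSum_weights e (x j)).mul_left (w j)
  rwa [(h.mem j).1, one_pow, mul_one] at h2

theorem apply_sumRankOne_eq {μ : ℂ} {c : ι → ℝ} (h : ∀ j, c j = 0 ∨ A (x j) = μ • x j) (v : H) :
    A (sumRankOne c x v) = μ • sumRankOne c x v := by
  rw [sumRankOne_apply, map_sum, Finset.smul_sum]
  refine Finset.sum_congr rfl fun j _ => ?_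
  rcases h j with h | h
  · simp [h]
  · rw [map_smul, map_smul, h, smul_comm μ, smul_comm μ]

variable [CompleteSpace H]

theorem isSelfAdjoint_sumRankOne (c : ι → ℝ) (x : ι → H) : IsSelfAdjoint (sumRankOne c x) :=
  isSelfAdjoint_sum _ fun j _ => IsSelfAdjoint.smul (Complex.conj_ofReal _)
    (InnerProductSpace.isPositive_rankOne_self (x j)).isSelfAdjoint

theorem sumRankOne_nonneg {c : ι → ℝ} (hc : ∀ j, 0 ≤ c j) (x : ι → H) : 0 ≤ sumRankOne c x := by
  refine Finset.sum_nonneg fun j _ => ?_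
  rw [nonneg_iff_isPositive]
  exact (InnerProductSpace.isPositive_rankOne_self (x j)).smul_of_nonneg
    (Complex.zero_le_real.2 (hc j))

/-- Dropping the signs gives a positive operator with the same square: equal signs multiply to 1,
and vectors of opposite sign are orthogonal. Vectors of equal sign need not be orthogonal. -/
theorem IsCertificate.absOp_eq (h : IsCertificate e A w s x) :
    absOp (sumRankOne (fun j => w j * s j) x) = sumRankOne w x := by
  refine CFC.sqrt_unique ?_ (sumRankOne_nonneg h.nonneg x)
  rw [(isSelfAdjoint_sumRankOne _ x).star_eq]
  refine sumRankOne_mul_self _ _ _ fun j k => ?_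
  rcases eq_or_ne (s j) (s k) with hs | hs
  · left
    rcases h.sign k with hk | hk <;> simp [hs, hk]
  · exact Or.inr (h.inner_eq_zero j k hs)

/-- The eigenvalue `s j ‖A‖` cancels the sign since `s j ^ 2 = 1`; thus `X A = ‖A‖ |X|`, whence
equality in trace duality. -/
theorem IsCertificate.sumRankOne_mul_eq (h : IsCertificate e A w s x) (hA : IsSelfAdjoint A) :
    sumRankOne (fun j => w j * s j) x * A = (‖A‖ : ℂ) • sumRankOne w x := by
  ext v
  rw [mul_apply_eq_comp, smul_apply, sumRankOne_apply, sumRankOne_apply, Finset.smul_sum]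
  refine Finset.sum_congr rfl fun j _ => ?_
  have h1 : inner ℂ (x j) (A v) = inner ℂ (A (x j)) v := (hA.isSymmetric (x j) v).symm
  have h2 : (s j : ℂ) * s j = 1 := by rcases h.sign j with hj | hj <;> simp [hj]
  rw [h1, (h.mem j).2, inner_smul_left, Complex.conj_ofReal, smul_smul, smul_smul, smul_smul]
  congr 1
  push_cast
  linear_combination (w j * ‖A‖ * inner ℂ (x j) v) * h2

theorem IsCertificate.isWitness (h : IsCertificate e A w s x) (hA : IsSelfAdjoint A) :
    IsWitness e A (sumRankOne (fun j => w j * s j) x) := by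
  have hre : ∀ i, (inner ℂ (e i) (absOp (sumRankOne (fun j => w j * s j) x) (e i))).re =
      ∑ j, w j * weights e (x j) i := fun i => by
    rw [h.absOp_eq, inner_sumRankOne, Complex.ofReal_re]
  have htn : traceNorm e (sumRankOne (fun j => w j * s j) x) = 1 := by
    rw [traceNorm]
    simp_rw [hre]
    exact h.hasSum_diag.tsum_eq
  refine ⟨?_, ?_, fun i => ?_, ?_, ?_, ?_⟩
  · simp only [IsTraceClass, hre]
    exact h.hasSum_diag.summable
  · intro h0
    rw [h0] at htn
    simp [traceNorm, absOp] at htn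
  · rw [inner_sumRankOne]
    simp only [mul_assoc, h.diag i, Complex.ofReal_zero]
  · rw [htn, mul_one, h.sumRankOne_mul_eq hA, trace]
    simp only [smul_apply, inner_smul_right, inner_sumRankOne]
    have h1 : HasSum (fun i => ((∑ j, w j * weights e (x j) i : ℝ) : ℂ)) ((1 : ℝ) : ℂ) :=
      Complex.hasSum_ofReal.2 h.hasSum_diag
    rw [(h1.mul_left _).tsum_eq]
    simp
  · ext v
    rw [mul_apply_eq_comp, projMax_apply_eq_self, posPartOp, h.absOp_eq, sumRankOne_add, smul_apply,
      map_smul, apply_sumRankOne_eq, smul_comm]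
    intro j
    rcases h.sign j with hj | hj
    · right
      rw [(h.mem j).2, hj, one_mul, h.lambda_eq.1]
    · left; simp [hj]
  · ext v
    rw [mul_apply_eq_comp, projMin_apply_eq_self, negPartOp, h.absOp_eq, sumRankOne_sub, smul_apply,
      map_smul, apply_sumRankOne_eq, smul_comm]
    intro j
    rcases h.sign j with hj | hj
    · left; simp [hj]
    · right
      rw [(h.mem j).2, hj, neg_one_mul, h.lambda_eq.2]

end Witness

/-! ### The case `A = 0`, where the eigenspace is not finite-dimensional. -/

section ZeroOperator

variable {H : Type*} [NormedAddCommGroup H] [InnerProductSpace ℂ H]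

/-- For `A = 0` the vectors `(e 0 ± e 1) / √2` give a certificate. -/
theorem exists_certificate_zero (e : HilbertBasis ℕ ℂ H) :
    ∃ (w s : Bool → ℝ) (x : Bool → H), IsCertificate e (0 : H →L[ℂ] H) w s x := by
  set s : Bool → ℝ := fun b => if b then 1 else -1 with hs
  set r : ℂ := (((√2)⁻¹ : ℝ) : ℂ) with hr
  set x : Bool → H := fun b => r • (e 0 + (s b : ℂ) • e 1) with hx
  have horth : ∀ i j, inner ℂ (e i) (e j) = if i = j then (1 : ℂ) else 0 :=
    orthonormal_iff_ite.1 e.orthonormal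
  have hr2 : r * r = 1 / 2 := by
    rw [hr, ← Complex.ofReal_mul, ← mul_inv, Real.mul_self_sqrt (by norm_num)]
    simp
  have hrc : (starRingEnd ℂ) r = r := Complex.conj_ofReal _
  have hin : ∀ b c, inner ℂ (x b) (x c) = (1 / 2 : ℂ) * (1 + s b * s c) := fun b c => by
    simp only [hx, inner_smul_left, inner_smul_right, inner_add_left, inner_add_right, horth, hrc,
      Complex.conj_ofReal]
    simp only [if_true, zero_ne_one, one_ne_zero, if_false]
    linear_combination (1 + (s b : ℂ) * s c) * hr2
  refine ⟨fun _ => 1 / 2, s, x, fun _ => by norm_num, by norm_num, fun b => ?_, fun b => ⟨?_, ?_⟩,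
    fun b c hbc => ?_, fun i => ?_⟩
  · cases b <;> simp [hs]
  · have h1 := inner_self_eq_norm_sq_to_K (𝕜 := ℂ) (x b)
    rw [hin] at h1
    have h2 : ((‖x b‖ ^ 2 : ℝ) : ℂ) = (1 : ℝ) := by
      push_cast
      refine h1.symm.trans ?_
      cases b <;> simp [hs] <;> norm_num
    have h3 := Complex.ofReal_injective h2
    exact (pow_eq_one_iff_of_nonneg (norm_nonneg _) two_ne_zero).1 h3
  · simp
  · rw [hin]
    cases b <;> cases c <;> simp_all
  · rw [Fintype.sum_bool]
    -- The relative sign of `e 0` and `e 1` is invisible on the diagonal, so the two opposite terms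
    -- cancel.
    have h1 : weights e (x true) i = weights e (x false) i := by
      simp only [weights, hx, hs, inner_smul_right, inner_add_right, horth]
      rcases eq_or_ne i 0 with rfl | h0
      · simp
      · simp [h0]
        split_ifs <;> simp
    rw [h1]
    simp [hs]

end ZeroOperator

/-! ### Excluding separation, and the equivalence. -/

section Equivalence

variable {H : Type*} [NormedAddCommGroup H] [InnerProductSpace ℂ H] [CompleteSpace H]

/-- Eigenvectors realizing the third condition refute separation. -/
theorem not_separates_of_inner_le {A : H →L[ℂ] H} (hA : IsCompactHermitian A) (h0 : A ≠ 0)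
    (hsum : lambdaMin A + lambdaMax A = 0) {D : H →L[ℂ] H} {y z : H}
    (hy : y ∈ (projMax A).range) (hz : z ∈ (projMin A).range) (hy1 : ‖y‖ = 1) (hz1 : ‖z‖ = 1)
    (hle : (inner ℂ y (D y)).re ≤ (inner ℂ z (D z)).re) : ¬Separates A D := by
  -- One of `±‖A‖` is an eigenvalue; `hsum` then fixes both ends of the spectrum.
  have hmax : lambdaMax A = ‖A‖ := by
    rcases unitEigenvectors_nonempty hA h0 with h | h
    · exact lambdaMax_eq_norm h
    · have := lambdaMin_eq_neg_norm h
      linarith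
  have hmin : lambdaMin A = -‖A‖ := by linarith
  rw [mem_range_projMax, hmax] at hy
  rw [mem_range_projMin, hmin] at hz
  intro hsep
  have h1 := hsep.1 y ⟨hy1, by rwa [one_mul]⟩
  have h2 := hsep.2 z ⟨hz1, by rwa [neg_one_mul]⟩
  linarith

/-- The diagonal operator `D₁ - ε D` would be a better approximant. -/
theorem not_separates_of_isMinimal {e : HilbertBasis ℕ ℂ H} {C D₁ : H →L[ℂ] H}
    (hA : IsCompactHermitian (C + D₁)) (h0 : C + D₁ ≠ 0) (hD₁ : IsCompactRealDiagonal e D₁)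
    (hmin : IsMinimal e C D₁) {D : H →L[ℂ] H} (hD : IsCompactRealDiagonal e D) :
    ¬Separates (C + D₁) D := by
  intro hsep
  obtain ⟨ε, hε⟩ := exists_norm_sub_smul_lt hA h0 hD.1 hsep
  have h1 : IsCompactRealDiagonal e (D₁ - (ε : ℂ) • D) := by
    refine ⟨⟨hD₁.1.1.sub (hD.1.1.smul (ε : ℂ)),
      hD₁.1.2.sub (IsSelfAdjoint.smul (Complex.conj_ofReal _) hD.1.2)⟩, fun i j hij => ?_⟩
    simp [hD₁.2 i j hij, hD.2 i j hij]
  have h2 := hmin _ h1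
  rw [← add_sub_assoc] at h2
  exact absurd hε (not_lt.2 h2)

/-- If no diagonal operator separates, there is a certificate. -/
theorem exists_certificate (e : HilbertBasis ℕ ℂ H) {A : H →L[ℂ] H} (hA : IsCompactHermitian A)
    (h : A ≠ 0 → ∀ D, IsCompactRealDiagonal e D → ¬Separates A D) :
    ∃ (ι : Type) (_ : Fintype ι) (w s : ι → ℝ) (x : ι → H), IsCertificate e A w s x := by
  rcases eq_or_ne A 0 with rfl | h0
  · exact ⟨Bool, inferInstance, exists_certificate_zero e⟩
  · refine (exists_certificate_or_separates e hA h0).resolve_right ?_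
    rintro ⟨D, hD, hsep⟩
    exact h h0 D hD hsep

end Equivalence

end MinimalCompact

end

theorem mainTheorem1 {H : Type*} [NormedAddCommGroup H] [InnerProductSpace ℂ H] [CompleteSpace H]
    (e : HilbertBasis ℕ ℂ H) (C D₁ : H →L[ℂ] H)
    (hC : MinimalCompact.IsCompactHermitian C)
    (hD₁ : MinimalCompact.IsCompactRealDiagonal e D₁) :
    List.TFAE [
      MinimalCompact.IsMinimal e C D₁,
      ∃ X : H →L[ℂ] H, MinimalCompact.IsWitness e (C + D₁) X,
      ∃ X : H →L[ℂ] H, IsSelfAdjoint X ∧ MinimalCompact.IsWitness e (C + D₁) X,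
      MinimalCompact.lambdaMin (C + D₁) + MinimalCompact.lambdaMax (C + D₁) = 0 ∧
        ∀ D : H →L[ℂ] H, MinimalCompact.IsCompactRealDiagonal e D →
          ∃ y ∈ (MinimalCompact.projMax (C + D₁)).range,
          ∃ z ∈ (MinimalCompact.projMin (C + D₁)).range,
            ‖y‖ = 1 ∧ ‖z‖ = 1 ∧ (inner ℂ y (D y)).re ≤ (inner ℂ z (D z)).re] := by
  have hA : MinimalCompact.IsCompactHermitian (C + D₁) := ⟨hC.1.add hD₁.1.1, hC.2.add hD₁.1.2⟩
  tfae_have 1 → 3 := fun hmin => by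
    obtain ⟨ι, _, w, s, x, h⟩ := MinimalCompact.exists_certificate e hA fun h0 D hD =>
      MinimalCompact.not_separates_of_isMinimal hA h0 hD₁ hmin hD
    exact ⟨_, MinimalCompact.isSelfAdjoint_sumRankOne _ x, h.isWitness hA.2⟩
  tfae_have 3 → 2 := fun ⟨X, _, hX⟩ => ⟨X, hX⟩
  tfae_have 2 → 1 := fun ⟨X, hX⟩ => MinimalCompact.isMinimal_of_isWitness hD₁ hX
  tfae_have 1 → 4 := fun hmin => by
    obtain ⟨ι, _, w, s, x, h⟩ := MinimalCompact.exists_certificate e hA fun h0 D hD =>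
      MinimalCompact.not_separates_of_isMinimal hA h0 hD₁ hmin hD
    refine ⟨?_, fun D hD => h.exists_mem_range hD⟩
    rw [h.lambda_eq.1, h.lambda_eq.2, neg_add_cancel]
  tfae_have 4 → 3 := fun ⟨hsum, hD4⟩ => by
    obtain ⟨ι, _, w, s, x, h⟩ := MinimalCompact.exists_certificate e hA fun h0 D hD => by
      obtain ⟨y, hy, z, hz, hy1, hz1, hle⟩ := hD4 D hD
      exact MinimalCompact.not_separates_of_inner_le hA h0 hsum hy hz hy1 hz1 hle
    exact ⟨_, MinimalCompact.isSelfAdjoint_sumRankOne _ x, h.isWitness hA.2⟩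
  tfae_finish
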